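/- All rings are associative and unital with $1\neq 0$, and subrings contain the identity of the ring. A maximal subring of a ring $T$ is a proper subring $S\subsetneq T$ such that no subring of $T$ lies strictly between $S$ and $T$. A Hilbert ring is a commutative ring $R$ such that in $R/I$, for every proper ideal $I$ of $R$, the set of nilpotent elements equals the Jacobson radical. $J(R)$ denotes the Jacobson radical of a ring $R$, and $C(T)$ denotes the center of a ring $T$. Let $T$ be a (not necessarily commutative) domain that is integral over its center $C(T)$, i.e. every element of $T$ is a root of a monic polynomial of degree at least $1$ with coefficients in $C(T)$. If $J(C(T))=0$, then either $T$ has a maximal subring, or $T$ is commutative (hence an integral domain), $T$ is a Hilbert ring, $J(T)=0$, and $|T|\leq 2^{2^{\aleph_0}}$. -/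

import Mathlib

/-- A ring `T` has a maximal subring: a proper (unital) subring `S` of `T` such that no subring
of `T` lies strictly between `S` and `T`, i.e. a coatom of the lattice of subrings. -/
def HasMaximalSubring (T : Type*) [Ring T] : Prop :=
  ∃ S : Subring T, IsCoatom S

/-- A (not necessarily commutative) ring `T` is a Hilbert integral domain: its multiplication is
commutative and, as a commutative ring, it is an integral domain and a Hilbert (Jacobson) ring. -/
def IsHilbertIntegralDomain (T : Type*) [Ring T] : Prop :=
  ∃ h : ∀ a b : T, a * b = b * a,
    letI : CommRing T := { ‹Ring T› with mul_comm := h }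
    IsDomain T ∧ IsJacobsonRing T

/-! Suppose `T` has no maximal subring; then no quotient of `T` has one. A nonzero integral element
has a nonzero central multiple, so `J(C(T)) = 0` forces `J(T) = 0`. Maximal left ideals are
two-sided (`of_not_isTwoSided`), and the division rings they cut out are commutative
(`of_isIntegral_center`), so commutators lie in `J(T) = 0`.

For commutative domains the engine is `of_not_isIntegral_unit`: a unit `u` not integral over ℤ
yields a maximal subring. In a field containing the domain, choose a subring `A` maximal among those
in which `u⁻¹` is a nonunit and every nonzero element divides a power of `u⁻¹`; inverting `u⁻¹`
turns `A` into the whole field. With all units integral over ℤ, every domain quotient has zero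
Jacobson radical, which is the Hilbert property, and residue fields are countable. Distinct maximal
ideals have non-isomorphic residue fields, so there are at most `2 ^ ℵ₀` of them, and `T` embeds in
the product of these fields. -/

/-! ### Constructions of maximal subrings. -/

theorem HasMaximalSubring.of_surjective {T R : Type*} [Ring T] [Ring R] (f : T →+* R)
    (hf : Function.Surjective f) (h : HasMaximalSubring R) : HasMaximalSubring T := by
  obtain ⟨S, hS, hmax⟩ := h
  refine ⟨S.comap f, fun h => hS ?_, fun S' hS' => ?_⟩
  · rw [eq_top_iff]
    intro r _
    obtain ⟨t, rfl⟩ := hf r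
    have : t ∈ S.comap f := h ▸ Subring.mem_top t
    exact this
  · obtain ⟨hle, hne⟩ := SetLike.lt_iff_le_and_exists.1 hS'
    obtain ⟨t, ht, htn⟩ := hne
    have key : S'.map f = ⊤ := by
      apply hmax
      refine SetLike.lt_iff_le_and_exists.2 ⟨fun s hs => ?_, f t, ⟨t, ht, rfl⟩, htn⟩
      obtain ⟨r, rfl⟩ := hf s
      exact ⟨r, hle hs, rfl⟩
    rw [eq_top_iff]
    intro r _
    obtain ⟨s, hs, hsr⟩ : f r ∈ S'.map f := key ▸ Subring.mem_top _
    have : r - s ∈ S' := hle (by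
      change f (r - s) ∈ S
      rw [map_sub, hsr, sub_self]; exact S.zero_mem)
    simpa using S'.add_mem this hs

/-- Zorn above `E`: the union of a chain of proper subrings stays proper, since otherwise a single
member would contain the finite set `s`. -/
theorem HasMaximalSubring.of_closure_union_finite {T : Type*} [Ring T] (E : Subring T)
    (hE : E ≠ ⊤) (s : Set T) (hs : s.Finite) (h : Subring.closure (E ∪ s) = ⊤) :
    HasMaximalSubring T := by
  have htop : ∀ S : Subring T, E ≤ S → s ⊆ S → S = ⊤ := fun S h1 h2 => by
    rw [eq_top_iff, ← h, Subring.closure_le]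
    exact Set.union_subset h1 h2
  obtain ⟨S, hES, hS⟩ := zorn_le_nonempty₀ {S : Subring T | E ≤ S ∧ S ≠ ⊤}
    (fun c hcs hc y hy => by
      have hne : c.Nonempty := ⟨y, hy⟩
      have hdir : DirectedOn (· ≤ ·) c := hc.directedOn
      refine ⟨sSup c, ⟨(hcs hy).1.trans (le_sSup hy), fun htop' => ?_⟩, fun z hz => le_sSup hz⟩
      have hcov : ∀ x ∈ s, ∃ S ∈ c, x ∈ S := fun x _ =>
        (Subring.mem_sSup_of_directedOn hne hdir).1 (htop'.symm ▸ Subring.mem_top x)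
      have : ∃ S ∈ c, s ⊆ (S : Set T) := by
        clear h htop
        induction s, hs using Set.Finite.induction_on with
        | empty => exact ⟨y, hy, Set.empty_subset _⟩
        | @insert a s _ _ ih =>
          obtain ⟨S, hS, h1⟩ := ih fun x hx => hcov x (Set.mem_insert_of_mem _ hx)
          obtain ⟨S', hS', h2⟩ := hcov a (Set.mem_insert _ _)
          obtain ⟨S'', hS'', h3, h4⟩ := hdir S hS S' hS'
          exact ⟨S'', hS'', Set.insert_subset (h4 h2) (h1.trans h3)⟩
      obtain ⟨S, hS, hsS⟩ := this
      exact (hcs hS).2 (htop S (hcs hS).1 hsS)) E ⟨le_rfl, hE⟩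
  refine ⟨S, hS.prop.2, fun S' hS' => ?_⟩
  by_contra hne
  exact hS'.not_ge (hS.le_of_ge ⟨hES.trans hS'.le, hne⟩ hS'.le)

/-- The idealizer of `L` is a maximal subring: it contains `L`, and any `r` outside it satisfies `L
+ L r = T`. -/
theorem HasMaximalSubring.of_not_isTwoSided {T : Type*} [Ring T] (L : Ideal T) [hL : L.IsMaximal]
    (h : ¬ L.IsTwoSided) : HasMaximalSubring T := by
  let S : Subring T :=
    { carrier := {r | ∀ l ∈ L, l * r ∈ L}
      mul_mem' := fun {a b} ha hb l hl => by
        rw [← mul_assoc]; exact hb _ (ha _ hl)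
      one_mem' := fun l hl => by simpa using hl
      add_mem' := fun {a b} ha hb l hl => by
        rw [mul_add]; exact L.add_mem (ha _ hl) (hb _ hl)
      zero_mem' := fun l _ => by simp
      neg_mem' := fun {a} ha l hl => by
        rw [mul_neg]; exact L.neg_mem (ha _ hl) }
  have hLS : ∀ l ∈ L, l ∈ S := fun l hl l' _ => L.mul_mem_left _ hl
  refine ⟨S, fun hS => h ⟨fun {a} b ha => ?_⟩, fun S' hS' => ?_⟩
  · have : b ∈ S := hS ▸ Subring.mem_top b
    exact this a ha
  · obtain ⟨hle, r, hr, hrS⟩ := SetLike.lt_iff_le_and_exists.1 hS'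
    obtain ⟨l, hl, hlr⟩ : ∃ l ∈ L, l * r ∉ L := by
      by_contra! hcon
      exact hrS hcon
    let N : Ideal T := L ⊔ Submodule.map (LinearMap.toSpanSingleton T T r) L
    have hN : N = ⊤ := by
      apply hL.out.2
      refine SetLike.lt_iff_le_and_exists.2 ⟨le_sup_left, l * r, ?_, hlr⟩
      exact (le_sup_right : _ ≤ N) ⟨l, hl, by simp⟩
    rw [eq_top_iff]
    intro t _
    obtain ⟨a, ha, b, hb, rfl⟩ := Submodule.mem_sup.1 (show t ∈ N from hN ▸ Submodule.mem_top)
    obtain ⟨c, hc, rfl⟩ := hb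
    refine S'.add_mem (hle (hLS a ha)) ?_
    simpa using S'.mul_mem (hle (hLS c hc)) hr

theorem HasMaximalSubring.of_surjective_prod {T K : Type*} [CommRing T] [Field K] (f g : T →+* K)
    (h : ∀ a b : K, ∃ t, f t = a ∧ g t = b) : HasMaximalSubring T := by
  refine ⟨f.eqLocus g, fun htop => ?_, fun S' hS' => ?_⟩
  · obtain ⟨t, h1, h0⟩ := h 1 0
    have : t ∈ f.eqLocus g := htop ▸ Subring.mem_top t
    have : f t = g t := this
    simp_all
  · obtain ⟨hle, s, hs, hsS⟩ := SetLike.lt_iff_le_and_exists.1 hS'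
    have hsne : f s - g s ≠ 0 := fun h0 => hsS (sub_eq_zero.1 h0)
    rw [eq_top_iff]
    intro t _
    -- Under `(f, g)`, `s - b` has second coordinate zero, and `c` rescales its first coordinate to
    -- `f t - g t`.
    obtain ⟨b, hb, hb'⟩ := h (g s) (g s)
    obtain ⟨c, hc, hc'⟩ := h ((f t - g t) / (f s - g s)) ((f t - g t) / (f s - g s))
    have hbS : b ∈ S' := hle (show f b = g b by rw [hb, hb'])
    have hcS : c ∈ S' := hle (show f c = g c by rw [hc, hc'])
    have hd : t - c * (s - b) ∈ S' := hle (by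
      change f _ = g _
      simp only [map_sub, map_mul, hb, hb', hc, hc']
      field_simp
      ring)
    simpa using S'.add_mem hd (S'.mul_mem hcS (S'.sub_mem hs hbS))

/-- `R` is a finitely generated left module over the centralizer of `a`. The vectors `w r = (r, a r,
…, aⁿ⁻¹ r)` span a finite-dimensional left space, and the coordinates of `w r` in a basis of such
vectors commute with `a`. -/
theorem HasMaximalSubring.of_isIntegral_center {R : Type*} [DivisionRing R] (a : R)
    (ha : IsIntegral (Subring.center R) a) (hc : a ∉ Subring.center R) : HasMaximalSubring R := by
  obtain ⟨p, hp, hpa⟩ := ha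
  set n := p.natDegree with hn
  let w : R → Fin n → R := fun r i => a ^ (i : ℕ) * r
  have hcomm : ∀ (c : Subring.center R) (r : R), (c : R) * r = r * c := fun c r =>
    (Subring.mem_center_iff.1 c.2 r).symm
  have hrec : a ^ n = - ∑ i ∈ Finset.range n, (p.coeff i : R) * a ^ i := by
    rw [Polynomial.eval₂_eq_sum_range, Finset.sum_range_succ, ← hn, hp.coeff_natDegree, map_one,
      one_mul] at hpa
    rw [eq_neg_iff_add_eq_zero, add_comm]
    exact hpa
  have hpos : 0 < n := by
    rcases Nat.eq_zero_or_pos n with h | h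
    · rw [h] at hrec; simp at hrec
    · exact h
  obtain ⟨b, hbsub, hbspan, hbli⟩ := exists_linearIndependent R (Set.range w)
  have hfin : b.Finite := hbli.setFinite
  choose! e he using fun x (hx : x ∈ b) => hbsub hx
  have := hfin.fintype
  have hext : ∀ (d : b → R) (r : R), (∀ i : ℕ, i < n → a ^ i * r = ∑ j, d j * (a ^ i * e j)) →
      a ^ n * r = ∑ j, d j * (a ^ n * e j) := by
    intro d r h
    rw [hrec]
    simp only [neg_mul, Finset.sum_mul, mul_neg, Finset.sum_neg_distrib, Finset.mul_sum]
    rw [Finset.sum_comm]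
    congr 1
    refine Finset.sum_congr rfl fun i hi => ?_
    rw [mul_assoc, h i (Finset.mem_range.1 hi), Finset.mul_sum]
    refine Finset.sum_congr rfl fun j _ => ?_
    rw [← mul_assoc, hcomm, mul_assoc, mul_assoc, ← mul_assoc _ (p.coeff i : R), ← hcomm]
  have hrep : ∀ r : R, ∃ d : b → R, (∀ j, d j ∈ Subring.centralizer {a}) ∧ r = ∑ j, d j * e j := by
    intro r
    have hr : w r ∈ Submodule.span R b := hbspan ▸ Submodule.subset_span ⟨r, rfl⟩
    obtain ⟨d, hd⟩ : ∃ d : b → R, ∑ j, d j • (j : Fin n → R) = w r := by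
      have : w r ∈ Submodule.span R (Set.range (Subtype.val : b → Fin n → R)) := by simpa using hr
      exact (Submodule.mem_span_range_iff_exists_fun R).1 this
    have h1 : ∀ i : ℕ, i < n → a ^ i * r = ∑ j, d j * (a ^ i * e j) := fun i hi => by
      have := congrFun hd ⟨i, hi⟩
      rw [Finset.sum_apply] at this
      rw [show a ^ i * r = w r ⟨i, hi⟩ from rfl, ← this]
      refine Finset.sum_congr rfl fun j _ => ?_
      conv_lhs => rw [← he j j.2]
      rfl
    have h2 : ∀ i : ℕ, i < n → a ^ (i + 1) * r = ∑ j, d j * (a ^ (i + 1) * e j) := fun i hi => by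
      rcases (Nat.succ_le_of_lt hi).lt_or_eq with h | h
      · exact h1 _ h
      · rw [show i + 1 = n from h]; exact hext d r h1
    -- Both `∑ d j * a • w (e j)` and `a • ∑ d j • w (e j)` equal `w (a * r)`; independence then
    -- gives `d j * a = a * d j`.
    have hz : ∑ j, (d j * a - a * d j) • (j : Fin n → R) = 0 := by
      ext i
      rw [Finset.sum_apply]
      have : ∀ j : b, ((d j * a - a * d j) • (j : Fin n → R)) i =
          d j * (a ^ ((i : ℕ) + 1) * e j) - a * (d j * (a ^ (i : ℕ) * e j)) := fun j => by
        conv_lhs => rw [← he j j.2]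
        change (d j * a - a * d j) * (a ^ (i : ℕ) * e j) = _
        rw [pow_succ']; noncomm_ring
      rw [Finset.sum_congr rfl fun j _ => this j, Finset.sum_sub_distrib, ← Finset.mul_sum,
        ← h1 i i.2, ← h2 i i.2, pow_succ', mul_assoc, sub_self]; rfl
    refine ⟨d, fun j => ?_, ?_⟩
    · have := Fintype.linearIndependent_iff.1 hbli _ hz j
      rw [Subring.mem_centralizer_iff]
      rintro _ rfl
      exact (sub_eq_zero.1 this).symm
    · simpa using h1 0 hpos
  refine .of_closure_union_finite (Subring.centralizer {a}) (fun htop => hc ?_) (Set.range fun j : b => e j)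
    (Set.finite_range _) ?_
  · rw [Subring.mem_center_iff]
    intro g
    have : g ∈ Subring.centralizer {a} := htop ▸ Subring.mem_top g
    exact (Subring.mem_centralizer_iff.1 this a rfl).symm
  · rw [eq_top_iff]
    intro r _
    obtain ⟨d, hd, rfl⟩ := hrep r
    exact Subring.sum_mem _ fun j _ => Subring.mul_mem _ (Subring.subset_closure (Or.inl (hd j)))
      (Subring.subset_closure (Or.inr ⟨j, rfl⟩))

/-! ### Passage from the center to `T`, and commutativity. -/

/-- Cancel `x` from a monic equation until its constant term has nonzero image; that term is then a
multiple of `x`. -/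
theorem exists_algebraMap_ne_zero_eq_mul_of_isIntegral {A B : Type*} [CommRing A] [Ring B]
    [IsDomain B] [Algebra A B] {x : B} (hx : IsIntegral A x) (hx0 : x ≠ 0) :
    ∃ (c : A) (q : Polynomial A), algebraMap A B c ≠ 0 ∧
      algebraMap A B c = Polynomial.aeval x q * x := by
  obtain ⟨p, hp, hpx⟩ := hx
  replace hpx : Polynomial.aeval x p = 0 := hpx
  have : Nontrivial A := (algebraMap A B).domain_nontrivial
  induction h : p.natDegree generalizing p with
  | zero =>
    rw [hp.natDegree_eq_zero.1 h] at hpx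
    simp at hpx
  | succ n ih =>
    have hdecomp : Polynomial.aeval x p.divX * x + algebraMap A B (p.coeff 0) = 0 := by
      rw [← hpx]
      conv_rhs => rw [← p.divX_mul_X_add]
      simp
    by_cases h0 : algebraMap A B (p.coeff 0) = 0
    · rw [h0, add_zero, mul_eq_zero, or_iff_left hx0] at hdecomp
      refine ih p.divX ?_ hdecomp (by rw [Polynomial.natDegree_divX_eq_natDegree_tsub_one, h]; simp)
      rw [Polynomial.Monic, Polynomial.leadingCoeff, Polynomial.natDegree_divX_eq_natDegree_tsub_one,
        Polynomial.coeff_divX, h, Nat.add_sub_cancel, ← h]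
      exact hp
    · exact ⟨p.coeff 0, -p.divX, h0,
        by rw [map_neg, neg_mul, eq_neg_iff_add_eq_zero, add_comm]; exact hdecomp⟩

theorem jacobson_eq_bot_of_isIntegral_center {T : Type*} [Ring T] [IsDomain T]
    (hint : Algebra.IsIntegral (Subring.center T) T)
    (hJ : Ring.jacobson (Subring.center T) = ⊥) : Ring.jacobson T = ⊥ := by
  rw [eq_bot_iff]
  intro x hx
  by_contra hx0
  obtain ⟨c, q, hc0, hc⟩ := exists_algebraMap_ne_zero_eq_mul_of_isIntegral
    (hint.isIntegral x) (show x ≠ 0 from hx0)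
  have hcJ : (c : T) ∈ Ideal.jacobson (⊥ : Ideal T) := by
    rw [Ideal.jacobson_bot]
    have h1 : Polynomial.aeval x q * x ∈ Ring.jacobson T := Ideal.mul_mem_left _ _ hx
    rwa [← hc] at h1
  have : c ∈ Ring.jacobson (Subring.center T) := by
    rw [← Ideal.jacobson_bot, Ideal.mem_jacobson_bot]
    intro d
    obtain ⟨z, hz⟩ := Ideal.mem_jacobson_iff.1 hcJ d
    have hz1 : z * (c * d + 1 : Subring.center T) = 1 := by
      have h1 : z * d * c + z - 1 = 0 := hz
      have h2 : (d : T) * c = c * d := Subring.mem_center_iff.1 c.2 d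
      rw [sub_eq_zero, mul_assoc, h2] at h1
      push_cast
      rw [mul_add, mul_one]; exact h1
    set e : Subring.center T := c * d + 1
    have hz2 : (e : T) * z = 1 := by
      rw [← Subring.mem_center_iff.1 e.2 z]; exact hz1
    -- The inverse of a central element is central, so invertibility descends to the center.
    have hzc : z ∈ Subring.center T := by
      rw [Subring.mem_center_iff]
      intro g
      calc g * z = z * e * (g * z) := by rw [hz1, one_mul]
        _ = z * (g * e) * z := by rw [Subring.mem_center_iff.1 e.2 g]; simp only [mul_assoc]
        _ = z * g := by rw [mul_assoc, mul_assoc, hz2, mul_one]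
    exact IsUnit.of_mul_eq_one ⟨z, hzc⟩ (Subtype.ext hz2)
  rw [hJ] at this
  exact hc0 (by rw [show c = 0 from this, map_zero])

theorem mul_comm_of_not_hasMaximalSubring {T : Type*} [Ring T]
    (hint : Algebra.IsIntegral (Subring.center T) T) (hJ : Ring.jacobson T = ⊥)
    (hT : ¬ HasMaximalSubring T) (a b : T) : a * b = b * a := by
  have hquot : ∀ L : Ideal T, L.IsMaximal → a * b - b * a ∈ L := by
    intro L hL
    have h2 : L.IsTwoSided := by
      by_contra h
      exact hT (.of_not_isTwoSided L h)
    have hntr : Nontrivial (T ⧸ L) := Ideal.Quotient.nontrivial_iff.2 hL.ne_top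
    have hinv : ∀ x : T ⧸ L, x ≠ 0 → ∃ y, y * x = 1 := by
      intro x hx
      obtain ⟨x, rfl⟩ := Ideal.Quotient.mk_surjective x
      have hxL : x ∉ L := fun h => hx (Ideal.Quotient.eq_zero_iff_mem.2 h)
      obtain ⟨y, hy⟩ := hL.exists_inv hxL
      obtain ⟨i, hi, h⟩ := hy
      exact ⟨Ideal.Quotient.mk L y, by
        rw [← map_mul, ← map_one (Ideal.Quotient.mk L), ← h, map_add,
          Ideal.Quotient.eq_zero_iff_mem.2 hi, add_zero]⟩
    have hu : ∀ x : T ⧸ L, IsUnit x ∨ x = 0 := by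
      intro x
      by_cases hx : x = 0
      · exact Or.inr hx
      · obtain ⟨y, hy⟩ := hinv x hx
        have hy0 : y ≠ 0 := by rintro rfl; simp at hy
        obtain ⟨z, hz⟩ := hinv y hy0
        have : z = x := by rw [← mul_one z, ← hy, ← mul_assoc, hz, one_mul]
        exact Or.inl ⟨⟨x, y, this ▸ hz, hy⟩, rfl⟩
    let : DivisionRing (T ⧸ L) := DivisionRing.ofIsUnitOrEqZero hu
    have hcen : ∀ c : Subring.center T, Ideal.Quotient.mk L c ∈ Subring.center (T ⧸ L) := by
      intro c
      rw [Subring.mem_center_iff]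
      intro g
      obtain ⟨g, rfl⟩ := Ideal.Quotient.mk_surjective g
      rw [← map_mul, ← map_mul, Subring.mem_center_iff.1 c.2 g]
    have hq : ¬ HasMaximalSubring (T ⧸ L) := fun h =>
      hT (h.of_surjective (Ideal.Quotient.mk L) Ideal.Quotient.mk_surjective)
    have hac : Ideal.Quotient.mk L a ∈ Subring.center (T ⧸ L) := by
      by_contra hac
      refine hq (.of_isIntegral_center _ ?_ hac)
      obtain ⟨p, hp, hpa⟩ := hint.isIntegral a
      let φ : Subring.center T →+* Subring.center (T ⧸ L) :=
        ((Ideal.Quotient.mk L).comp (Subring.center T).subtype).codRestrict _ hcen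
      refine ⟨p.map φ, hp.map φ, ?_⟩
      rw [Polynomial.eval₂_map]
      have := congrArg (Ideal.Quotient.mk L) hpa
      rw [Polynomial.hom_eval₂, map_zero] at this
      exact this
    rw [← Ideal.Quotient.eq_zero_iff_mem, map_sub, map_mul, map_mul,
      Subring.mem_center_iff.1 hac, sub_self]
  have : a * b - b * a ∈ Ideal.jacobson (⊥ : Ideal T) :=
    Ideal.mem_sInf.2 fun {L} hL => hquot L hL.2
  rw [Ideal.jacobson_bot, hJ] at this
  exact sub_eq_zero.1 this

/-! ### Integral inverses and polynomials over valuation rings. -/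

theorem exists_algebraMap_eq_inv_of_isIntegral {A K : Type*} [CommRing A] [Field K] [Algebra A K]
    {r : A} (h : IsIntegral A (algebraMap A K r)⁻¹) : ∃ s, algebraMap A K s = (algebraMap A K r)⁻¹ := by
  by_cases hr : algebraMap A K r = 0
  · exact ⟨0, by rw [hr, inv_zero, map_zero]⟩
  obtain ⟨p, hp, hpr⟩ := h
  have hrev : Polynomial.aeval (algebraMap A K r) p.reverse = 0 := by
    let := invertibleOfNonzero (inv_ne_zero hr)
    have := (Polynomial.eval₂_reverse_eq_zero_iff (algebraMap A K) _ p).2 hpr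
    rwa [invOf_eq_inv, inv_inv] at this
  rw [← p.reverse.divX_mul_X_add, Polynomial.coeff_zero_reverse, hp.leadingCoeff, map_add, map_mul,
    Polynomial.aeval_X, Polynomial.aeval_algebraMap_apply, map_one, map_one] at hrev
  refine ⟨-Polynomial.aeval r p.reverse.divX, eq_inv_of_mul_eq_one_left ?_⟩
  rw [map_neg, neg_mul]
  linear_combination -hrev

open Polynomial in
theorem IsLocalRing.map_residue_ne_zero_of_mul_eq {A : Type*} [CommRing A] [IsLocalRing A]
    {x : A} (hx : ¬ IsUnit x) {f g : A[X]} (hg : g.map (IsLocalRing.residue A) ≠ 0) :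
    C x * f ≠ g := by
  rintro rfl
  apply hg
  rw [Polynomial.map_mul, Polynomial.map_C, (IsLocalRing.residue_eq_zero_iff x).2
    ((IsLocalRing.mem_maximalIdeal x).2 hx), C_0, zero_mul]

open Polynomial in
/-- Over a valuation ring every nonzero polynomial is a scalar times a primitive one. -/
theorem ValuationRing.exists_eq_C_mul_map_residue_ne_zero {A : Type*} [CommRing A] [IsDomain A]
    [ValuationRing A] {f : A[X]} (hf : f ≠ 0) :
    ∃ (c : A) (h : A[X]), c ≠ 0 ∧ f = C c * h ∧ h.map (IsLocalRing.residue A) ≠ 0 := by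
  have key : ∀ s : Finset ℕ, s.Nonempty → ∃ i ∈ s, ∀ j ∈ s, f.coeff i ∣ f.coeff j := by
    intro s hs
    induction hs using Finset.Nonempty.cons_induction with
    | singleton a => exact ⟨a, by simp, by simp⟩
    | cons a s has hs ih =>
      obtain ⟨i, hi, h⟩ := ih
      rcases ValuationRing.dvd_total (f.coeff i) (f.coeff a) with h1 | h1
      · exact ⟨i, Finset.mem_cons_of_mem hi, fun j hj => by
          rcases Finset.mem_cons.1 hj with rfl | hj
          exacts [h1, h j hj]⟩
      · exact ⟨a, Finset.mem_cons_self _ _, fun j hj => by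
          rcases Finset.mem_cons.1 hj with rfl | hj
          exacts [dvd_rfl, h1.trans (h j hj)]⟩
  obtain ⟨i, hi, h⟩ := key f.support (Polynomial.nonempty_support_iff.2 hf)
  have hc : f.coeff i ≠ 0 := Polynomial.mem_support_iff.1 hi
  obtain ⟨q, hq⟩ : C (f.coeff i) ∣ f := by
    rw [Polynomial.C_dvd_iff_dvd_coeff]
    intro j
    by_cases hj : j ∈ f.support
    · exact h j hj
    · rw [Polynomial.notMem_support_iff.1 hj]; exact dvd_zero _
  refine ⟨f.coeff i, q, hc, hq, fun h0 => ?_⟩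
  have h1 : q.coeff i = 1 := by
    have := congrArg (fun p => Polynomial.coeff p i) hq
    simp only [Polynomial.coeff_C_mul] at this
    exact mul_left_cancel₀ hc (by rw [mul_one, ← this])
  have := congrArg (fun p => Polynomial.coeff p i) h0
  simp [h1] at this

/-! ### Maximal subrings of a field with a prescribed pseudo-uniformizer. -/

/-- `A` is a subring of the field `K` whose localization at `x ∈ A` is a field, while `x` is not
invertible in `A`. -/
structure IsPseudoUniformizer {K : Type*} [Field K] (A : Subring K) (x : K) : Prop where
  mem : x ∈ A
  inv_notMem : x⁻¹ ∉ A
  dvd_pow : ∀ a ∈ A, a ≠ 0 → ∃ n : ℕ, ∃ b ∈ A, a * b = x ^ n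

namespace IsPseudoUniformizer

variable {K : Type*} [Field K] {A : Subring K} {x : K}

theorem ne_zero (h : IsPseudoUniformizer A x) : x ≠ 0 := by
  rintro rfl
  exact h.inv_notMem (by rw [inv_zero]; exact A.zero_mem)

theorem exists_maximal (h : IsPseudoUniformizer A x) :
    ∃ B, Maximal (fun B : Subring K => IsPseudoUniformizer B x) B := by
  obtain ⟨B, -, hB⟩ := zorn_le_nonempty₀ {B : Subring K | IsPseudoUniformizer B x}
    (fun c hcs hc y hy => by
      have hne : c.Nonempty := ⟨y, hy⟩
      have hmem := fun {z : K} => Subring.mem_sSup_of_directedOn (x := z) hne hc.directedOn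
      refine ⟨sSup c, ⟨le_sSup hy (hcs hy).mem, fun hx => ?_, fun a ha ha0 => ?_⟩,
        fun z hz => le_sSup hz⟩
      · obtain ⟨S, hS, hxS⟩ := hmem.1 hx
        exact (hcs hS).inv_notMem hxS
      · obtain ⟨S, hS, haS⟩ := hmem.1 ha
        obtain ⟨n, b, hb, hab⟩ := (hcs hS).dvd_pow a haS ha0
        exact ⟨n, b, le_sSup hS hb, hab⟩) A h
  exact ⟨B, hB⟩

theorem mem_of_isIntegral (h : Maximal (fun B : Subring K => IsPseudoUniformizer B x) A) {z : K}
    (hz : IsIntegral A z) : z ∈ A := by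
  refine h.le_of_ge (y := (integralClosure A K).toSubring) ⟨?_, fun hx => ?_, fun a ha ha0 => ?_⟩
    (fun a ha => ?_) hz
  · exact isIntegral_algebraMap (x := (⟨x, h.prop.mem⟩ : A))
  · have hint : IsIntegral A x⁻¹ := hx
    obtain ⟨y, hy⟩ := exists_algebraMap_eq_inv_of_isIntegral (r := (⟨x, h.prop.mem⟩ : A)) hint
    replace hy : (y : K) = x⁻¹ := hy
    exact h.prop.inv_notMem (hy ▸ y.2)
  · obtain ⟨c, q, hc0, hc⟩ := exists_algebraMap_ne_zero_eq_mul_of_isIntegral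
      (show IsIntegral A a from ha) ha0
    obtain ⟨n, b, hb, hab⟩ := h.prop.dvd_pow c c.2 hc0
    refine ⟨n, Polynomial.aeval a q * b, ?_, ?_⟩
    · exact Subalgebra.mul_mem _ (Algebra.adjoin_singleton_le ha
          (Polynomial.aeval_mem_adjoin_singleton _ _))
        ((integralClosure A K).algebraMap_mem ⟨b, hb⟩)
    · rw [← hab, show (c : K) = _ from hc]; ring
  · exact isIntegral_algebraMap (x := (⟨a, ha⟩ : A))

/-- If `y ∉ A`, maximality forces `x⁻¹ ∈ A[y]`, that is, `1 - x p(y) = 0`. The constant term of this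
relation is a unit of `A`, so `y⁻¹` is integral over `A`, hence in `A`. -/
theorem mem_or_inv_mem (h : Maximal (fun B : Subring K => IsPseudoUniformizer B x) A) {y : K}
    {n : ℕ} (hn : x ^ n * y ∈ A) : y ∈ A ∨ y⁻¹ ∈ A := by
  by_cases hy : y ∈ A
  · exact Or.inl hy
  right
  have hx0 := h.prop.ne_zero
  have hy0 : y ≠ 0 := by rintro rfl; exact hy A.zero_mem
  have hB : ¬ IsPseudoUniformizer (Algebra.adjoin A {y}).toSubring x := fun hB =>
    hy (h.le_of_ge hB (fun a ha => (Algebra.adjoin A {y}).algebraMap_mem ⟨a, ha⟩)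
      (Algebra.subset_adjoin rfl))
  have hloc : ∀ z ∈ Algebra.adjoin A {y}, ∃ m : ℕ, x ^ m * z ∈ A := by
    intro z hz
    induction hz using Algebra.adjoin_induction with
    | mem z hz => obtain rfl := hz; exact ⟨n, hn⟩
    | algebraMap r => exact ⟨0, by rw [pow_zero, one_mul]; exact r.2⟩
    | add a b _ _ ha hb =>
      obtain ⟨k, hk⟩ := ha
      obtain ⟨l, hl⟩ := hb
      refine ⟨k + l, ?_⟩
      have : x ^ (k + l) * (a + b) = x ^ l * (x ^ k * a) + x ^ k * (x ^ l * b) := by ring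
      rw [this]
      exact A.add_mem (A.mul_mem (A.pow_mem h.prop.mem _) hk) (A.mul_mem (A.pow_mem h.prop.mem _) hl)
    | mul a b _ _ ha hb =>
      obtain ⟨k, hk⟩ := ha
      obtain ⟨l, hl⟩ := hb
      refine ⟨k + l, ?_⟩
      have : x ^ (k + l) * (a * b) = (x ^ k * a) * (x ^ l * b) := by ring
      rw [this]
      exact A.mul_mem hk hl
  have hxB : x⁻¹ ∈ Algebra.adjoin A {y} := by
    by_contra hxB
    refine hB ⟨(Algebra.adjoin A {y}).algebraMap_mem ⟨x, h.prop.mem⟩, hxB, fun a ha ha0 => ?_⟩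
    obtain ⟨m, hm⟩ := hloc a ha
    obtain ⟨k, b, hb, hab⟩ := h.prop.dvd_pow _ hm (mul_ne_zero (pow_ne_zero _ hx0) ha0)
    refine ⟨k, x ^ m * b, (Algebra.adjoin A {y}).algebraMap_mem
      ⟨x ^ m * b, A.mul_mem (A.pow_mem h.prop.mem _) hb⟩, ?_⟩
    rw [← hab]; ring
  rw [Algebra.adjoin_singleton_eq_range_aeval] at hxB
  obtain ⟨p, hp⟩ := hxB
  set X' : A := ⟨x, h.prop.mem⟩ with hX'
  let q : Polynomial A := 1 - Polynomial.C X' * p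
  have hq : Polynomial.aeval y q = 0 := by
    have hpx : Polynomial.aeval y p = x⁻¹ := hp
    simp only [q, map_sub, map_one, map_mul, Polynomial.aeval_C, hpx]
    change 1 - x * x⁻¹ = 0
    rw [mul_inv_cancel₀ hx0, sub_self]
  have hq0 : q.coeff 0 = 1 - X' * p.coeff 0 := by simp [q]
  have hu : IsUnit (q.coeff 0) := by
    have hne : q.coeff 0 ≠ 0 := by
      rw [hq0]
      intro h0
      have h1 : x * (p.coeff 0 : K) = 1 := by
        have := congrArg (Subtype.val) (sub_eq_zero.1 h0)
        exact this.symm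
      exact h.prop.inv_notMem (by rw [inv_eq_of_mul_eq_one_right h1]; exact (p.coeff 0).2)
    obtain ⟨m, b, hb, hab⟩ := h.prop.dvd_pow (q.coeff 0) (q.coeff 0).2
      (fun h0 => hne (Subtype.ext h0))
    have hcop : IsCoprime (q.coeff 0) X' := ⟨1, p.coeff 0, by rw [hq0]; ring⟩
    -- The constant term divides a power of `x` but is coprime to `x`.
    exact (hcop.pow_right (n := m)).isUnit_of_dvd' dvd_rfl ⟨⟨b, hb⟩, Subtype.ext hab.symm⟩
  have hlead : q.reverse.leadingCoeff = q.coeff 0 := by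
    rw [Polynomial.reverse_leadingCoeff, Polynomial.trailingCoeff,
      Polynomial.natTrailingDegree_eq_zero.2 (Or.inr hu.ne_zero)]
  have hrev : Polynomial.aeval y⁻¹ q.reverse = 0 := by
    let := invertibleOfNonzero hy0
    have := (Polynomial.eval₂_reverse_eq_zero_iff (algebraMap A K) y q).2 hq
    rwa [invOf_eq_inv] at this
  have hint := isIntegral_leadingCoeff_smul q.reverse y⁻¹ hrev
  rw [hlead] at hint
  have := mem_of_isIntegral h hint
  obtain ⟨u, hu⟩ := hu
  rw [← hu] at this
  have h2 := A.mul_mem (↑u⁻¹ : A).2 this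
  rwa [Algebra.smul_def, ← mul_assoc, show ((↑u⁻¹ : A) : K) * algebraMap A K u = 1 from
    congrArg Subtype.val u.inv_mul, one_mul] at h2

theorem valuationRing (h : Maximal (fun B : Subring K => IsPseudoUniformizer B x) A) :
    ValuationRing A := by
  refine { cond' := fun a b => ?_ }
  by_cases ha : a = 0
  · exact ⟨0, Or.inr (by rw [ha, mul_zero])⟩
  have ha' : (a : K) ≠ 0 := fun h0 => ha (Subtype.ext h0)
  obtain ⟨n, c, hc, hac⟩ := h.prop.dvd_pow a a.2 ha'
  have hmem : x ^ n * ((b : K) / a) ∈ A := by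
    rw [← hac, show (a : K) * c * (b / a) = c * b by field_simp]
    exact A.mul_mem hc b.2
  rcases mem_or_inv_mem h hmem with h1 | h1
  · exact ⟨⟨(b : K) / a, h1⟩, Or.inl (Subtype.ext (by change (a : K) * ((b : K) / a) = b; field_simp))⟩
  · by_cases hb : b = 0
    · exact ⟨0, Or.inl (by rw [hb, mul_zero])⟩
    have hb' : (b : K) ≠ 0 := fun h0 => hb (Subtype.ext h0)
    exact ⟨⟨((b : K) / a)⁻¹, h1⟩, Or.inr (Subtype.ext (by change (b : K) * ((b : K) / a)⁻¹ = a; field_simp))⟩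

theorem exists_pow_mul_mem_of_isAlgebraic
    (h : Maximal (fun B : Subring K => IsPseudoUniformizer B x) A) {t : K}
    (ht : IsAlgebraic A t) : ∃ n : ℕ, x ^ n * t ∈ A := by
  obtain ⟨p, hp0, hp⟩ := ht
  have hint := mem_of_isIntegral h (isIntegral_leadingCoeff_smul p t hp)
  obtain ⟨n, b, hb, hab⟩ := h.prop.dvd_pow p.leadingCoeff p.leadingCoeff.2
    (fun h0 => hp0 (Polynomial.leadingCoeff_eq_zero.1 (Subtype.ext h0)))
  refine ⟨n, ?_⟩
  rw [← hab, mul_comm (_ : K) b, mul_assoc]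
  exact A.mul_mem hb hint

open Polynomial in
theorem isAlgebraic (h : Maximal (fun B : Subring K => IsPseudoUniformizer B x) A) (t : K) :
    IsAlgebraic A t := by
  by_contra ht
  have hinj : Function.Injective (aeval t : A[X] →ₐ[A] K) := transcendental_iff_injective.1 ht
  have := valuationRing h
  let ρ := IsLocalRing.residue A
  have hne : ∀ g : A[X], g.map ρ ≠ 0 → aeval t g ≠ 0 := fun g hg h0 => by
    rw [(map_eq_zero_iff _ hinj).1 h0] at hg
    simp at hg
  -- The Gauss extension of `A`: `A[t]` localized at the polynomials with nonzero reduction. It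
  -- keeps `x` a pseudo-uniformizer and contains `t`, against maximality.
  let B : Subring K :=
    { carrier := {z | ∃ f g : A[X], g.map ρ ≠ 0 ∧ z * aeval t g = aeval t f}
      mul_mem' := by
        rintro z w ⟨f, g, hg, hz⟩ ⟨f', g', hg', hw⟩
        refine ⟨f * f', g * g', by rw [Polynomial.map_mul]; exact mul_ne_zero hg hg', ?_⟩
        rw [map_mul, map_mul, ← hz, ← hw]; ring
      one_mem' := ⟨1, 1, by simp, by simp⟩
      add_mem' := by
        rintro z w ⟨f, g, hg, hz⟩ ⟨f', g', hg', hw⟩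
        refine ⟨f * g' + f' * g, g * g', by rw [Polynomial.map_mul]; exact mul_ne_zero hg hg', ?_⟩
        rw [map_mul, map_add, map_mul, map_mul, ← hz, ← hw]; ring
      zero_mem' := ⟨0, 1, by simp, by simp⟩
      neg_mem' := by
        rintro z ⟨f, g, hg, hz⟩
        exact ⟨-f, g, hg, by rw [map_neg, ← hz]; ring⟩ }
  have hAB : A ≤ B := fun a ha => ⟨C ⟨a, ha⟩, 1, by simp, by
    rw [map_one, mul_one, aeval_C]; rfl⟩
  have hx : ¬ IsUnit (⟨x, h.prop.mem⟩ : A) := by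
    intro hu
    obtain ⟨y, hy⟩ := hu.exists_right_inv
    exact h.prop.inv_notMem (by
      rw [inv_eq_of_mul_eq_one_right (congrArg Subtype.val hy : x * (y : K) = 1)]; exact y.2)
  have hB : IsPseudoUniformizer B x := by
    refine ⟨hAB h.prop.mem, ?_, ?_⟩
    · rintro ⟨f, g, hg, hz⟩
      refine IsLocalRing.map_residue_ne_zero_of_mul_eq hx (f := f) hg (hinj ?_)
      rw [map_mul, aeval_C, ← hz]
      change x * _ = _
      rw [mul_inv_cancel_left₀ h.prop.ne_zero]
    · rintro z ⟨f, g, hg, hz⟩ hz0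
      have hf : f ≠ 0 := by
        rintro rfl
        rw [map_zero] at hz
        exact mul_ne_zero hz0 (hne g hg) hz
      obtain ⟨c, q, hc, rfl, hq⟩ := ValuationRing.exists_eq_C_mul_map_residue_ne_zero hf
      obtain ⟨n, b, hb, hcb⟩ := h.prop.dvd_pow c c.2 (fun h0 => hc (Subtype.ext h0))
      have hq0 := hne q hq
      refine ⟨n, b * aeval t g / aeval t q, ⟨C ⟨b, hb⟩ * g, q, hq, ?_⟩, ?_⟩
      · rw [div_mul_cancel₀ _ hq0, map_mul, aeval_C]; rfl
      · rw [map_mul, aeval_C] at hz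
        have hz' : z * aeval t g = c * aeval t q := hz
        rw [← hcb]
        field_simp
        linear_combination b * hz'
  have htA : t ∈ A := h.le_of_ge hB hAB ⟨X, 1, by simp, by simp⟩
  exact ht (isAlgebraic_algebraMap (⟨t, htA⟩ : A))

theorem of_valuation {F Γ : Type*} [Field F] [LinearOrderedCommGroupWithZero Γ] [MulArchimedean Γ]
    (v : Valuation F Γ) (φ : F →+* K) {y : F} (hy0 : y ≠ 0) (hy : v y < 1) :
    IsPseudoUniformizer (v.integer.map φ) (φ y) := by
  refine ⟨⟨y, hy.le, rfl⟩, ?_, ?_⟩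
  · rintro ⟨z, hz, hzy⟩
    rw [← map_inv₀] at hzy
    rw [φ.injective hzy] at hz
    have hz' : v y⁻¹ ≤ 1 := hz
    rw [map_inv₀, inv_le_one₀ (zero_lt_iff.2 ((Valuation.ne_zero_iff v).2 hy0))] at hz'
    exact hz'.not_gt hy
  · rintro _ ⟨a, ha, rfl⟩ ha0
    have ha0 : a ≠ 0 := by rintro rfl; simp at ha0
    have hva : v a ≠ 0 := (Valuation.ne_zero_iff v).2 ha0
    obtain ⟨n, hn⟩ := exists_pow_lt₀ hy (Units.mk0 _ hva)
    refine ⟨n, φ (y ^ n / a), ⟨y ^ n / a, ?_, rfl⟩, ?_⟩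
    · change v (y ^ n / a) ≤ 1
      rw [map_div₀, map_pow]
      exact div_le_one_of_le₀ hn.le zero_le
    · rw [← map_mul, ← map_pow]; congr 1; field_simp

theorem exists_of_isDedekindDomain (O : Type*) {F : Type*} [CommRing O] [IsDedekindDomain O] [Field F]
    [Algebra O F] [IsFractionRing O F] (φ : F →+* K) {y : F} (hy : y⁻¹ ∉ (algebraMap O F).range) :
    ∃ A : Subring K, IsPseudoUniformizer A (φ y) := by
  obtain ⟨v, hv⟩ : ∃ v : IsDedekindDomain.HeightOneSpectrum O, ¬ v.valuation F y⁻¹ ≤ 1 := by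
    by_contra! hcon
    exact hy (IsDedekindDomain.HeightOneSpectrum.mem_integers_of_valuation_le_one F _ hcon)
  have hy0 : y ≠ 0 := by rintro rfl; simp at hv
  rw [map_inv₀, not_le, one_lt_inv₀ (zero_lt_iff.2 ((Valuation.ne_zero_iff _).2 hy0))] at hv
  exact ⟨_, of_valuation (v.valuation F) φ hy0 hv⟩

open Polynomial in
theorem exists_of_transcendental {k : Type*} [Field k] [Algebra k K] (hx : Transcendental k x) :
    ∃ A : Subring K, IsPseudoUniformizer A x := by
  have hinj : Function.Injective (aeval x : k[X] →ₐ[k] K) := transcendental_iff_injective.1 hx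
  let φ : FractionRing k[X] →+* K := IsFractionRing.lift (g := (aeval x : k[X] →ₐ[k] K).toRingHom) hinj
  have hφ : φ (algebraMap k[X] _ X) = x := by
    rw [IsFractionRing.lift_algebraMap]
    exact aeval_X x
  rw [← hφ]
  refine exists_of_isDedekindDomain k[X] φ ?_
  rintro ⟨f, hf⟩
  have hX : algebraMap k[X] (FractionRing k[X]) X ≠ 0 := by
    rw [Ne, FaithfulSMul.algebraMap_eq_zero_iff]; exact X_ne_zero
  have h1 : X * f = 1 := by
    apply FaithfulSMul.algebraMap_injective k[X] (FractionRing k[X])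
    rw [map_mul, hf, mul_inv_cancel₀ hX, map_one]
  exact Polynomial.not_isUnit_X (IsUnit.of_mul_eq_one _ h1)

open NumberField IntermediateField in
-- If `x` is transcendental over the prime field, a valuation of the rational function field serves.
-- If it is algebraic, the characteristic must be zero, and a prime of the number field `ℚ⟮x⟯` with
-- `x` of positive valuation serves.
theorem exists_of_not_isIntegral_inv (hx : ¬ IsIntegral ℤ x⁻¹) :
    ∃ A : Subring K, IsPseudoUniformizer A x := by
  obtain ⟨p, hp⟩ := CharP.exists K
  rcases CharP.char_is_prime_or_zero K p with hprime | rfl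
  · have : Fact p.Prime := ⟨hprime⟩
    let := ZMod.algebra K p
    by_cases hal : IsAlgebraic (ZMod p) x
    · exfalso
      apply hx
      have : Algebra.IsIntegral ℤ (ZMod p) :=
        ⟨fun z => by
          obtain ⟨n, rfl⟩ := ZMod.intCast_surjective z
          exact isIntegral_algebraMap (x := n)⟩
      exact isIntegral_trans _ (hal.isIntegral.inv)
    · exact exists_of_transcendental hal
  · have : CharZero K := CharP.charP_to_charZero K
    by_cases hal : IsAlgebraic ℚ x
    · have : FiniteDimensional ℚ ℚ⟮x⟯ := adjoin.finiteDimensional hal.isIntegral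
      have : NumberField ℚ⟮x⟯ := ⟨⟩
      refine exists_of_isDedekindDomain (𝓞 ℚ⟮x⟯) (y := AdjoinSimple.gen ℚ x) (algebraMap ℚ⟮x⟯ K) ?_
      rintro ⟨z, hz⟩
      apply hx
      have := (RingOfIntegers.isIntegral_coe z).map (algebraMap ℚ⟮x⟯ K).toIntAlgHom
      rw [hz] at this
      simpa using this
    · exact exists_of_transcendental hal

end IsPseudoUniformizer

/-! ### Units not integral over ℤ, and the Hilbert property. -/

theorem HasMaximalSubring.of_injective_of_not_isIntegral_unit {R K : Type*} [CommRing R] [Field K]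
    (ι : R →+* K) (hι : Function.Injective ι) (u : Rˣ) (hu : ¬ IsIntegral ℤ (u : R)) :
    HasMaximalSubring R := by
  let x : K := ι (↑u⁻¹ : R)
  have hxu : x⁻¹ = ι u := inv_eq_of_mul_eq_one_right (by rw [← map_mul, u.inv_mul, map_one])
  obtain ⟨A₀, hA₀⟩ := IsPseudoUniformizer.exists_of_not_isIntegral_inv (x := x) (by
    rw [hxu]
    intro h
    exact hu ((isIntegral_algHom_iff ι.toIntAlgHom hι).1 h))
  obtain ⟨A, hA⟩ := hA₀.exists_maximal
  refine .of_closure_union_finite (A.comap ι) (fun htop => ?_) {(u : R)} (Set.finite_singleton _) ?_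
  · refine hA.prop.inv_notMem ?_
    rw [hxu]
    have : (u : R) ∈ A.comap ι := htop.symm ▸ Subring.mem_top (u : R)
    exact this
  · rw [eq_top_iff]
    intro r _
    obtain ⟨n, hn⟩ := IsPseudoUniformizer.exists_pow_mul_mem_of_isAlgebraic hA
      (IsPseudoUniformizer.isAlgebraic hA (ι r))
    have h1 : (↑u⁻¹ : R) ^ n * r ∈ A.comap ι := by
      change ι _ ∈ A
      rw [map_mul, map_pow]; exact hn
    have h2 : r = (u : R) ^ n * ((↑u⁻¹ : R) ^ n * r) := by
      rw [← mul_assoc, ← mul_pow, u.mul_inv, one_pow, one_mul]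
    rw [h2]
    have hu' : (u : R) ∈ Subring.closure ((A.comap ι : Set R) ∪ {(u : R)}) :=
      Subring.subset_closure (Set.mem_union_right _ rfl)
    exact mul_mem (pow_mem hu' _) (Subring.subset_closure (Set.mem_union_left _ h1))

theorem HasMaximalSubring.of_not_isIntegral_unit {R : Type*} [CommRing R] [IsDomain R] (u : Rˣ)
    (hu : ¬ IsIntegral ℤ (u : R)) : HasMaximalSubring R :=
  .of_injective_of_not_isIntegral_unit (algebraMap R (FractionRing R))
    (IsFractionRing.injective R _) u hu

theorem Int.isUnit_of_isIntegral_inv_cast {K : Type*} [Field K] [CharZero K] {m : ℤ} (hm : m ≠ 0)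
    (h : IsIntegral ℤ (m : K)⁻¹) : IsUnit m := by
  obtain ⟨k, hk⟩ := exists_algebraMap_eq_inv_of_isIntegral (A := ℤ) (r := m) h
  replace hk : (k : K) = (m : K)⁻¹ := hk
  refine IsUnit.of_mul_eq_one k ?_
  have hmK : (m : K) ≠ 0 := by exact_mod_cast hm
  have h2 : (m : K) * k = 1 := by
    rw [hk, mul_inv_cancel₀ hmK]
  exact_mod_cast h2

/-- For `x` in the radical, `1 + x` is a unit, so `x` is integral over ℤ; a nonzero `x` then puts a
nonzero integer `n` in the radical. -/
theorem jacobson_bot_eq_bot_of_not_hasMaximalSubring {D : Type*} [CommRing D] [IsDomain D]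
    (hD : ¬ HasMaximalSubring D) : Ideal.jacobson (⊥ : Ideal D) = ⊥ := by
  have hU : ∀ u : Dˣ, IsIntegral ℤ (u : D) := fun u => by
    by_contra h
    exact hD (.of_not_isIntegral_unit u h)
  rw [eq_bot_iff]
  intro x hx
  by_contra hx0
  obtain ⟨u, hu⟩ := Ideal.mem_jacobson_bot.1 hx 1
  have hxint : IsIntegral ℤ x := by
    have := (hU u).sub (isIntegral_one (R := ℤ))
    rwa [hu, mul_one, add_sub_cancel_right] at this
  obtain ⟨n, q, hn0, hn⟩ := exists_algebraMap_ne_zero_eq_mul_of_isIntegral hxint (show x ≠ 0 from hx0)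
  have hnJ : (n : D) ∈ Ideal.jacobson (⊥ : Ideal D) := by
    have := Ideal.mul_mem_left _ (Polynomial.aeval x q) hx
    rwa [← hn] at this
  replace hn0 : (n : D) ≠ 0 := hn0
  obtain ⟨p, hp⟩ := CharP.exists D
  rcases CharP.char_is_prime_or_zero D p with hprime | rfl
  · have : Fact p.Prime := ⟨hprime⟩
    have hz : (n : ZMod p) ≠ 0 := by
      rw [Ne, ZMod.intCast_zmod_eq_zero_iff_dvd]
      rwa [Ne, CharP.intCast_eq_zero_iff D p] at hn0
    have hnu : IsUnit (n : D) := by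
      have := (IsUnit.mk0 _ hz).map (ZMod.castHom dvd_rfl D)
      simpa using this
    obtain ⟨v, hv⟩ := hnu.exists_right_inv
    have := Ideal.mem_jacobson_bot.1 hnJ (-v)
    rw [mul_neg, hv, neg_add_cancel] at this
    exact not_isUnit_zero this
  · have : CharZero D := CharP.charP_to_charZero D
    have hn0' : n ≠ 0 := by rintro rfl; simp at hn0
    -- Testing against `n` itself makes `n * n + 1` a unit; it exceeds 1, so its inverse cannot be
    -- integral over ℤ.
    obtain ⟨v, hv⟩ := Ideal.mem_jacobson_bot.1 hnJ n
    have hint := hU v⁻¹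
    let ι : D →+* FractionRing D := algebraMap D _
    have hι : Function.Injective ι := IsFractionRing.injective D _
    have : CharZero (FractionRing D) := charZero_of_injective_ringHom hι
    have hint' := map_isIntegral_int ι hint
    have hvm : ι (↑v⁻¹ : D) = ((n * n + 1 : ℤ) : FractionRing D)⁻¹ := by
      symm
      apply inv_eq_of_mul_eq_one_right
      have : ((n * n + 1 : ℤ) : FractionRing D) = ι v := by
        rw [hv]; simp
      rw [this, ← map_mul, v.mul_inv, map_one]
    rw [hvm] at hint'
    have hpos : 0 < n * n := mul_self_pos.2 hn0'
    have := Int.isUnit_of_isIntegral_inv_cast (by omega) hint'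
    rw [Int.isUnit_iff] at this
    omega

theorem isJacobsonRing_of_not_hasMaximalSubring {T : Type*} [CommRing T]
    (hT : ¬ HasMaximalSubring T) : IsJacobsonRing T := by
  rw [isJacobsonRing_iff_prime_eq]
  intro P hP
  rw [Ideal.jacobson_eq_iff_jacobson_quotient_eq_bot]
  exact jacobson_bot_eq_bot_of_not_hasMaximalSubring fun h =>
    hT (h.of_surjective (Ideal.Quotient.mk P) Ideal.Quotient.mk_surjective)

/-! ### Cardinality bounds. -/

theorem countable_of_forall_isIntegral_int {K : Type*} [CommRing K] [IsDomain K]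
    (h : ∀ x : K, IsIntegral ℤ x) : Countable K := by
  classical
  have hcov : (Set.univ : Set K) ⊆ ⋃ p : Polynomial ℤ, 
      ((p.map (Int.castRingHom K)).roots.toFinset : Set K) := by
    intro x _
    obtain ⟨p, hp, hx⟩ := h x
    refine Set.mem_iUnion.2 ⟨p, ?_⟩
    simp only [Finset.mem_coe, Multiset.mem_toFinset]
    rw [Polynomial.mem_roots (hp.map _).ne_zero, Polynomial.IsRoot, Polynomial.eval_map]
    exact hx
  have : Countable (Polynomial ℤ) := Cardinal.mk_le_aleph0_iff.1
    (Polynomial.cardinalMk_le_max.trans (by simp))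
  have : (Set.univ : Set K).Countable :=
    (Set.countable_iUnion fun p => Finset.countable_toSet _).mono hcov
  exact Set.countable_univ_iff.1 this

theorem countable_of_not_hasMaximalSubring {K : Type*} [Field K] (hK : ¬ HasMaximalSubring K) :
    Countable K := by
  refine countable_of_forall_isIntegral_int fun x => ?_
  by_cases hx : x = 0
  · rw [hx]; exact isIntegral_zero
  · by_contra h
    exact hK (.of_not_isIntegral_unit (Units.mk0 x hx) h)

open Cardinal in
-- Each residue field is a quotient of `ℤ[X₀, X₁, …]`. Equal kernels for distinct maximal ideals
-- would give isomorphic residue fields, and the equalizer of the two residue maps would be a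
-- maximal subring.
theorem mk_maximalSpectrum_le_of_not_hasMaximalSubring {T : Type*} [CommRing T]
    (hT : ¬ HasMaximalSubring T) : #(MaximalSpectrum T) ≤ 2 ^ ℵ₀ := by
  have hcount : ∀ M : MaximalSpectrum T, Countable (T ⧸ M.asIdeal) := fun M => by
    let : Field (T ⧸ M.asIdeal) := Ideal.Quotient.field _
    exact countable_of_not_hasMaximalSubring fun h =>
      hT (h.of_surjective (Ideal.Quotient.mk M.asIdeal) Ideal.Quotient.mk_surjective)
  have hsurj : ∀ M : MaximalSpectrum T, ∃ φ : MvPolynomial ℕ ℤ →+* T ⧸ M.asIdeal,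
      Function.Surjective φ := fun M => by
    obtain ⟨f, hf⟩ := exists_surjective_nat (T ⧸ M.asIdeal)
    refine ⟨MvPolynomial.eval₂Hom (Int.castRingHom _) f, fun y => ?_⟩
    obtain ⟨n, rfl⟩ := hf y
    exact ⟨MvPolynomial.X n, by simp⟩
  choose φ hφ using hsurj
  have hinj : Function.Injective fun M => (RingHom.ker (φ M) : Set (MvPolynomial ℕ ℤ)) := by
    intro M N hMN
    replace hMN : RingHom.ker (φ M) = RingHom.ker (φ N) := SetLike.coe_injective hMN
    by_contra hne
    let : Field (T ⧸ M.asIdeal) := Ideal.Quotient.field _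
    let e : T ⧸ N.asIdeal ≃+* T ⧸ M.asIdeal :=
      (RingHom.quotientKerEquivOfSurjective (hφ N)).symm.trans
        ((Ideal.quotEquivOfEq hMN.symm).trans (RingHom.quotientKerEquivOfSurjective (hφ M)))
    refine hT (.of_surjective_prod (Ideal.Quotient.mk M.asIdeal)
      ((e : T ⧸ N.asIdeal →+* T ⧸ M.asIdeal).comp (Ideal.Quotient.mk N.asIdeal)) fun a b => ?_)
    have hcop : IsCoprime M.asIdeal N.asIdeal :=
      Ideal.isCoprime_of_isMaximal fun h => hne (MaximalSpectrum.ext h)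
    obtain ⟨i, hi, j, hj, hij⟩ := Ideal.isCoprime_iff_exists.1 hcop
    obtain ⟨s, rfl⟩ := Ideal.Quotient.mk_surjective a
    obtain ⟨t, ht⟩ := Ideal.Quotient.mk_surjective (e.symm b)
    have hb : b = e (Ideal.Quotient.mk N.asIdeal t) := by rw [ht, e.apply_symm_apply]
    refine ⟨s * j + t * i, ?_, ?_⟩
    · rw [Ideal.Quotient.eq]
      have : s * j + t * i - s = (t - s) * i := by linear_combination s * hij
      rw [this]; exact Ideal.mul_mem_left _ _ hi
    · rw [hb]
      change e _ = e _
      congr 1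
      rw [Ideal.Quotient.eq]
      have : s * j + t * i - t = (s - t) * j := by linear_combination t * hij
      rw [this]; exact Ideal.mul_mem_left _ _ hj
  have hle := Cardinal.lift_mk_le_lift_mk_of_injective hinj
  rw [Cardinal.mk_set, Cardinal.lift_uzero] at hle
  refine hle.trans ?_
  rw [Cardinal.lift_power, Cardinal.lift_two]
  exact Cardinal.power_le_power_left two_ne_zero
    (Cardinal.lift_le_aleph0.2 (MvPolynomial.cardinalMk_le_max.trans (by simp)))

open Cardinal in
theorem mk_le_of_not_hasMaximalSubring {T : Type*} [CommRing T]
    (hT : ¬ HasMaximalSubring T) (hJ : Ring.jacobson T = ⊥) : #T ≤ 2 ^ (2 ^ ℵ₀ : Cardinal) := by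
  have hcount : ∀ M : MaximalSpectrum T, Countable (T ⧸ M.asIdeal) := fun M => by
    let : Field (T ⧸ M.asIdeal) := Ideal.Quotient.field _
    exact countable_of_not_hasMaximalSubring fun h =>
      hT (h.of_surjective (Ideal.Quotient.mk M.asIdeal) Ideal.Quotient.mk_surjective)
  have := fun M : MaximalSpectrum T => exists_injective_nat (T ⧸ M.asIdeal)
  choose f hf using this
  have hinj : Function.Injective fun (t : T) (M : MaximalSpectrum T) =>
      f M (Ideal.Quotient.mk M.asIdeal t) := by
    intro s t hst
    have : s - t ∈ Ideal.jacobson (⊥ : Ideal T) := Ideal.mem_sInf.2 fun {M} hM =>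
      Ideal.Quotient.eq.1 (hf ⟨M, hM.2⟩ (congrFun hst ⟨M, hM.2⟩))
    rw [Ideal.jacobson_bot, hJ] at this
    exact sub_eq_zero.1 this
  have h1 := Cardinal.mk_le_of_injective hinj
  calc #T ≤ ℵ₀ ^ #(MaximalSpectrum T) := by simpa using h1
    _ ≤ ℵ₀ ^ (2 ^ ℵ₀ : Cardinal) := Cardinal.power_le_power_left aleph0_ne_zero
      (mk_maximalSpectrum_le_of_not_hasMaximalSubring hT)
    _ = 2 ^ (2 ^ ℵ₀ : Cardinal) :=
      Cardinal.power_eq_two_power (Cardinal.cantor _).le natCast_lt_aleph0.le (Cardinal.cantor _).le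

theorem lemma4p10 {T : Type*} [Ring T] [IsDomain T]
    (hint : Algebra.IsIntegral (Subring.center T) T)
    (hJ : Ring.jacobson (Subring.center T) = ⊥) :
    HasMaximalSubring T ∨
      (IsHilbertIntegralDomain T ∧ Ring.jacobson T = ⊥ ∧
        Cardinal.mk T ≤ (2 : Cardinal) ^ ((2 : Cardinal) ^ Cardinal.aleph0)) := by
  by_cases hT : HasMaximalSubring T
  · exact Or.inl hT
  right
  have hJT := jacobson_eq_bot_of_isIntegral_center hint hJ
  have hcomm := mul_comm_of_not_hasMaximalSubring hint hJT hT
  refine ⟨⟨hcomm, ?_⟩, hJT, ?_⟩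
  · let : CommRing T := { ‹Ring T› with mul_comm := hcomm }
    exact ⟨‹IsDomain T›, isJacobsonRing_of_not_hasMaximalSubring hT⟩
  · let : CommRing T := { ‹Ring T› with mul_comm := hcomm }
    exact mk_le_of_not_hasMaximalSubring hT hJT
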